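/- Let $-\infty<a<b\le+\infty$, let $w>0$ and $p\neq0$ a.e. on $[a,b)$ with $w,1/p,q\in L^1_{loc}[a,b)$, $w$ real, $p,q$ complex-valued, and let $b$ be singular, i.e. $b=+\infty$ or $\int_a^b(w+1/|p|+|q|)\,dx=\infty$. Put $\mathcal M[y]=w^{-1}(-(py')'+qy)$, $[u,v]:=p(uv'-u'v)$, and assume that $Q=\overline{\mathrm{co}}\{q(x)/w(x)+rp(x):x\in[a,b),\,0<r<\infty\}\neq\mathbb C$. Let $\alpha\in\mathbb C$ and let $(\eta,K)\in\mathbb R\times\mathbb C$ be admissible: for some $\lambda_0\in\mathbb C\setminus Q$, $K$ is the nearest point of $Q$ to $\lambda_0$, $\Re[(rp(x)+q(x)/w(x)-K)e^{i\eta}]\ge0$ for all $x\in[a,b)$, $r>0$, and $\Re[(\lambda_0-K)e^{i\eta}]<0$; and moreover $\Re[e^{i\eta}\cos\alpha\,\overline{\sin\alpha}]\le0$. Put $\Lambda_{\eta,K}=\{\lambda:\Re[(\lambda-K)e^{i\eta}]\le0\}$. Suppose that the equation is in Sims Case II or III at $b$: for some $\lambda_1\in\Lambda_{\eta,K}$ all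 solutions of $\mathcal M[y]=\lambda_1y$ lie in $L^2_w[a,b)$ and the condition $$\int_a^b\Re[e^{i\eta}\{p|y'|^2+(q-Kw)|y|^2\}]\,dx+\int_a^b|y|^2w\,dx<\infty$$ is satisfied either by exactly one nontrivial solution up to constant multiples (Case II) or by all solutions (Case III). For $\lambda\in\mathbb C$ let $\theta(\cdot,\lambda),\phi(\cdot,\lambda)$ be the solutions of $\mathcal M[y]=\lambda y$ with $\theta(a,\lambda)=\cos\alpha$, $p\theta'(a,\lambda)=\sin\alpha$, $\phi(a,\lambda)=\sin\alpha$, $p\phi'(a,\lambda)=-\cos\alpha$. Fix $\lambda'\in\Lambda_{\eta,K}$ and a number $m(\lambda')\in\mathbb C$, and let $\psi=\theta(\cdot,\lambda')+m(\lambda')\phi(\cdot,\lambda')$. Let $M$ be the realization of $\mathcal M$ in $L^2_w[a,b)$ with domain given by the boundary conditions $y(a)\cos\alpha+py'(a)\sin\alpha=0$ and $[y,\psi](b)=\lim_{x\to b}[y,\psi](x)=0$. For $\lambda$ not an eigenvalue of $M$ let $m(\lambda)$ be the number for which $\theta(\cdot,\lambda)+m(\lambda)\phi(\cdot,\lambda)$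 lies in $L^2_w[a,b)$ and satisfies the boundary condition at $b$. Let $b_n\in(a,b)$, $b_n\nearrow b$, let $M_n$ be the regular realization of $\mathcal M$ on $[a,b_n]$ with boundary conditions $y(a)\cos\alpha+py'(a)\sin\alpha=0$ and $[y,\psi](b_n)=0$, and for $\lambda$ not an eigenvalue of $M_n$ let $m_n(\lambda)$ be the number with $[\theta(\cdot,\lambda)+m_n(\lambda)\phi(\cdot,\lambda),\psi](b_n)=0$. Then for every compact set $\mathcal K\subset\mathbb C$ containing no eigenvalue of $M$: $m(\lambda)$ exists and is unique for each $\lambda\in\mathcal K$; for all sufficiently large $n$ the set $\mathcal K$ contains no eigenvalue of $M_n$ and $m_n(\lambda)$ exists and is unique for each $\lambda\in\mathcal K$; and $m_n(\lambda)\to m(\lambda)$ as $n\to\infty$, uniformly for $\lambda\in\mathcal K$. -/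

import Mathlib

open MeasureTheory Filter Topology

noncomputable section

/-- A Sturm–Liouville expression `𝓜[y] = w⁻¹ (-(p y')' + q y)` on `[a, b)`, `a ∈ ℝ`, `b ≤ +∞`,
with complex `p, q` and real `w`, regular at `a` and singular at `b`, for which the closed convex
hull of the points `q(x)/w(x) + r p(x)` is not the whole plane. As `w > 0` is only assumed almost
everywhere, the hull is taken over those `x` at which the quotient makes sense. -/
structure SturmLiouville where
  a : ℝ
  b : EReal
  a_lt_b : (a : EReal) < b
  p : ℝ → ℂ
  q : ℝ → ℂ
  w : ℝ → ℝ
  w_pos : ∀ᵐ x ∂(volume.restrict {x : ℝ | a ≤ x ∧ (x : EReal) < b}), 0 < w x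
  p_ne : ∀ᵐ x ∂(volume.restrict {x : ℝ | a ≤ x ∧ (x : EReal) < b}), p x ≠ 0
  w_loc : LocallyIntegrableOn w {x : ℝ | a ≤ x ∧ (x : EReal) < b}
  p_loc : LocallyIntegrableOn (fun x => (p x)⁻¹) {x : ℝ | a ≤ x ∧ (x : EReal) < b}
  q_loc : LocallyIntegrableOn q {x : ℝ | a ≤ x ∧ (x : EReal) < b}
  hull_ne : closure (convexHull ℝ {z : ℂ | ∃ x : ℝ, (a ≤ x ∧ (x : EReal) < b) ∧ 0 < w x ∧
    ∃ r : ℝ, 0 < r ∧ z = q x / w x + r * p x}) ≠ Set.univ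
  singular : b = ⊤ ∨ ∫⁻ x in {x : ℝ | a ≤ x ∧ (x : EReal) < b},
    ENNReal.ofReal (w x + ‖p x‖⁻¹ + ‖q x‖) = ⊤

namespace SturmLiouville

variable (P : SturmLiouville)

/-- The interval `[a, b)`. -/
def I : Set ℝ := {x : ℝ | P.a ≤ x ∧ (x : EReal) < P.b}

/-- The set `Q`, the closed convex hull of all `q(x)/w(x) + r p(x)`, `x ∈ [a, b)`, `r > 0`. -/
def Q : Set ℂ := closure (convexHull ℝ {z : ℂ | ∃ x : ℝ, x ∈ P.I ∧ 0 < P.w x ∧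
    ∃ r : ℝ, 0 < r ∧ z = P.q x / P.w x + r * P.p x})

/-- `(η, K) ∈ S`: for some `lam₀ ∉ Q`, `K` is the nearest point of `Q` to `lam₀`, and after the
translation by `-K` and the rotation by `η` the set `Q` lies in the closed right half plane and
`lam₀` in the open left half plane. -/
def Admissible (η : ℝ) (K : ℂ) : Prop :=
  ∃ lam₀ : ℂ, lam₀ ∉ P.Q ∧ K ∈ P.Q ∧ (∀ z ∈ P.Q, dist lam₀ K ≤ dist lam₀ z) ∧
    (∀ x ∈ P.I, 0 < P.w x → ∀ r : ℝ, 0 < r →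
      0 ≤ ((r * P.p x + P.q x / P.w x - K) * Complex.exp (Complex.I * η)).re) ∧
    ((lam₀ - K) * Complex.exp (Complex.I * η)).re < 0

/-- `(η, K) ∈ S(α)`. -/
def AdmissibleAt (α : ℂ) (η : ℝ) (K : ℂ) : Prop :=
  P.Admissible η K ∧
    (Complex.exp (Complex.I * η) * Complex.cos α * starRingEnd ℂ (Complex.sin α)).re ≤ 0

/-- Functions are carried together with their quasi-derivative: `Y x = (y x, (p y') x)`.
`P.HasImage J Y f` says that, on the interval `J` with left end point `a`, both `y` and `p y'` are
locally absolutely continuous and `𝓜[y] = f`, i.e. `-(p y')' + q y = w f` almost everywhere. -/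
def HasImage (J : Set ℝ) (Y : ℝ → ℂ × ℂ) (f : ℝ → ℂ) : Prop :=
  (∀ c ∈ J, AbsolutelyContinuousOnInterval (fun x => (Y x).1) P.a c) ∧
  (∀ c ∈ J, AbsolutelyContinuousOnInterval (fun x => (Y x).2) P.a c) ∧
  (∀ᵐ x ∂(volume.restrict J), HasDerivAt (fun t => (Y t).1) ((Y x).2 / P.p x) x) ∧
  (∀ᵐ x ∂(volume.restrict J),
    HasDerivAt (fun t => (Y t).2) (P.q x * (Y x).1 - P.w x * f x) x)

/-- `Y = (y, p y')` is a solution of `𝓜[y] = lam y` on `[a, b)`. -/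
def IsSolution (lam : ℂ) (Y : ℝ → ℂ × ℂ) : Prop :=
  P.HasImage P.I Y (fun x => lam * (Y x).1)

/-- Membership in the weighted space `L²_w(J)`. -/
def L2w (J : Set ℝ) (f : ℝ → ℂ) : Prop :=
  AEStronglyMeasurable f (volume.restrict J) ∧ IntegrableOn (fun x => P.w x * ‖f x‖ ^ 2) J

/-- The condition `∫ Re[e^{iη} (p |y'|² + (q - K w) |y|²)] + ∫ |y|² w < ∞` over `[a, b)`, for
`Y = (y, p y')`. For admissible `(η, K)` both integrands are nonnegative almost everywhere. -/
def FiniteEnergy (η : ℝ) (K : ℂ) (Y : ℝ → ℂ × ℂ) : Prop :=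
  IntegrableOn (fun x => (Complex.exp (Complex.I * η) *
    (P.p x * (‖(Y x).2 / P.p x‖ ^ 2 : ℝ) + (P.q x - K * P.w x) * (‖(Y x).1‖ ^ 2 : ℝ))).re) P.I ∧
  P.L2w P.I (fun x => (Y x).1)

/-- Sims Case II (observed at the spectral parameter `lam`): up to constant multiples exactly one
nontrivial solution has finite energy, but all solutions lie in `L²_w`. -/
def SimsCaseII (η : ℝ) (K lam : ℂ) : Prop :=
  (∃ Y, P.IsSolution lam Y ∧ (∃ x ∈ P.I, (Y x).1 ≠ 0) ∧ P.FiniteEnergy η K Y ∧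
    ∀ Z, P.IsSolution lam Z → P.FiniteEnergy η K Z →
      ∃ c : ℂ, ∀ x ∈ P.I, (Z x).1 = c * (Y x).1) ∧
  ∀ Y, P.IsSolution lam Y → P.L2w P.I (fun x => (Y x).1)

/-- Sims Case III (observed at the spectral parameter `lam`): all solutions lie in `L²_w` and have
finite energy. -/
def SimsCaseIII (η : ℝ) (K lam : ℂ) : Prop :=
  ∀ Y, P.IsSolution lam Y → P.L2w P.I (fun x => (Y x).1) ∧ P.FiniteEnergy η K Y

/-- The filter `x → b` from within the real line, `x < b`. -/
def atEnd : Filter ℝ := comap (fun x : ℝ => (x : EReal)) (𝓝[<] P.b)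

/-- `y` belongs to the domain of `M` and `M y = f`. Here `M` is the realization of `𝓜` in
`L²_w[a, b)` with the boundary conditions `y(a) cos α + (p y')(a) sin α = 0` and
`[y, ψ](b) = lim_{x → b} [y, ψ](x) = 0`. -/
def opM (α : ℂ) (ψ Y : ℝ → ℂ × ℂ) (f : ℝ → ℂ) : Prop :=
  P.HasImage P.I Y f ∧ P.L2w P.I (fun x => (Y x).1) ∧ P.L2w P.I f ∧
  (Y P.a).1 * Complex.cos α + (Y P.a).2 * Complex.sin α = 0 ∧
  Tendsto (fun x => (Y x).1 * (ψ x).2 - (Y x).2 * (ψ x).1) P.atEnd (𝓝 0)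

/-- `y` belongs to the domain of the regular operator on `[a, c]` with the boundary conditions
`y(a) cos α + (p y')(a) sin α = 0` and `[y, ψ](c) = 0`, and is mapped to `f`. -/
def opReg (α : ℂ) (ψ : ℝ → ℂ × ℂ) (c : ℝ) (Y : ℝ → ℂ × ℂ) (f : ℝ → ℂ) : Prop :=
  P.HasImage (Set.Icc P.a c) Y f ∧ P.L2w (Set.Icc P.a c) (fun x => (Y x).1) ∧
  P.L2w (Set.Icc P.a c) f ∧
  (Y P.a).1 * Complex.cos α + (Y P.a).2 * Complex.sin α = 0 ∧
  (Y c).1 * (ψ c).2 - (Y c).2 * (ψ c).1 = 0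

/-- `lam` is an eigenvalue of `M`. -/
def IsEigenvalueM (α : ℂ) (ψ : ℝ → ℂ × ℂ) (lam : ℂ) : Prop :=
  ∃ Y, P.opM α ψ Y (fun x => lam * (Y x).1) ∧ ∃ x ∈ P.I, (Y x).1 ≠ 0

/-- `lam` is an eigenvalue of the regular operator on `[a, c]`. -/
def IsEigenvalueReg (α : ℂ) (ψ : ℝ → ℂ × ℂ) (c : ℝ) (lam : ℂ) : Prop :=
  ∃ Y, P.opReg α ψ c Y (fun x => lam * (Y x).1) ∧ ∃ x ∈ Set.Icc P.a c, (Y x).1 ≠ 0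

/-- `μ` is the value at a point of the Titchmarsh–Weyl function of `M`, where `Θ, Φ` are the
solutions `θ, φ` at that point: `θ + μ φ` lies in `L²_w[a, b)` and `[θ + μ φ, ψ](b) = 0`. -/
def IsWeylValue (ψ Θ Φ : ℝ → ℂ × ℂ) (μ : ℂ) : Prop :=
  P.L2w P.I (fun x => ((Θ + μ • Φ) x).1) ∧
  Tendsto (fun x => ((Θ + μ • Φ) x).1 * (ψ x).2 - ((Θ + μ • Φ) x).2 * (ψ x).1) P.atEnd (𝓝 0)

end SturmLiouville

/-- `μ` is the value at a point of the Titchmarsh–Weyl function of the regular operator on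
`[a, c]`: `[θ + μ φ, ψ](c) = 0`. -/
def IsRegWeylValue (ψ Θ Φ : ℝ → ℂ × ℂ) (c : ℝ) (μ : ℂ) : Prop :=
  ((Θ + μ • Φ) c).1 * (ψ c).2 - ((Θ + μ • Φ) c).2 * (ψ c).1 = 0

end

/-! Wherever the denominators do not vanish, `m = -[θ, ψ](b) / [φ, ψ](b)`, and `m_n` is the same
quotient taken at `b_n`. It therefore suffices that `[θ, ψ](x)` and `[φ, ψ](x)` converge as `x → b`,
uniformly for `lam ∈ 𝒦`, to continuous limits, and that the limit of `[φ, ψ]` has no zero on `𝒦`.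

By Lagrange's identity, `[y, ψ]' = (lam - lam') w y ψ` for a solution `y` at `lam`. Case II and Case
III both put `u = θ lam₁` and `v = φ lam₁` in `L²_w`, so `|w| (|u| + |v|)²` is integrable. Variation
of constants and Grönwall's inequality (`IsSolution.norm_fst_le`) bound all the solutions by `C (|u|
+ |v|)`, with one `C` for all `lam` in a bounded set. The tail integrals of the density then give
the uniform rate in `exists_tendstoUniformlyOn_wronskian`.

If the limit of `[φ, ψ]` vanished at some `lam ∈ 𝒦`, then `φ lam` would be an eigenfunction of `M`.
Hence the limit is bounded away from zero on the compact set, and so is `[φ, ψ](b_n)` for large `n`.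
This excludes eigenvalues of `M_n` and lets the quotients converge uniformly. -/

/-! ### Absolutely continuous functions and Grönwall's inequality -/

/-- Absolute continuity passes to a function whose increments are controlled by those of an
absolutely continuous function. -/
theorem AbsolutelyContinuousOnInterval.of_dist_le {X Y : Type*} [PseudoMetricSpace X]
    [PseudoMetricSpace Y] {f : ℝ → X} {g : ℝ → Y} {a b C : ℝ}
    (hf : AbsolutelyContinuousOnInterval f a b)
    (h : ∀ x ∈ Set.uIcc a b, ∀ y ∈ Set.uIcc a b, dist (g x) (g y) ≤ C * dist (f x) (f y)) :
    AbsolutelyContinuousOnInterval g a b := by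
  unfold AbsolutelyContinuousOnInterval at *
  refine squeeze_zero' ?_ ?_ (by simpa using hf.const_mul C)
  · exact Eventually.of_forall fun _ => Finset.sum_nonneg fun _ _ => dist_nonneg
  · rw [eventually_inf_principal]
    refine Eventually.of_forall fun E hE => ?_
    rw [Finset.mul_sum]
    exact Finset.sum_le_sum fun i hi => h _ (hE.1 i hi).1 _ (hE.1 i hi).2

/-- The increment of an absolutely continuous function is at most the integral of an upper bound
for its derivative. -/
theorem AbsolutelyContinuousOnInterval.sub_le_integral {f h : ℝ → ℝ} {a b : ℝ} (hab : a ≤ b)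
    (hf : AbsolutelyContinuousOnInterval f a b) (hh : IntervalIntegrable h volume a b)
    (hle : ∀ᵐ x, x ∈ Set.Icc a b → ∃ d, HasDerivAt f d x ∧ d ≤ h x) :
    f b - f a ≤ ∫ x in a..b, h x := by
  rw [← hf.integral_deriv_eq_sub]
  refine intervalIntegral.integral_mono_ae_restrict hab hf.intervalIntegrable_deriv hh ?_
  rw [EventuallyLE, ae_restrict_iff' measurableSet_Icc]
  filter_upwards [hle] with x hx hxm
  obtain ⟨d, hd, hdh⟩ := hx hxm
  rwa [hd.deriv]

/-- Mean value inequality for absolutely continuous complex functions. -/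
theorem AbsolutelyContinuousOnInterval.norm_sub_le_integral {f : ℝ → ℂ} {h : ℝ → ℝ} {a b : ℝ}
    (hab : a ≤ b) (hf : AbsolutelyContinuousOnInterval f a b)
    (hh : IntervalIntegrable h volume a b)
    (hle : ∀ᵐ x, x ∈ Set.Icc a b → ∃ d, HasDerivAt f d x ∧ ‖d‖ ≤ h x) :
    ‖f b - f a‖ ≤ ∫ x in a..b, h x := by
  -- Rotating the increment onto the positive real axis reduces the claim to the real function `Re
  -- (u f)`.
  obtain ⟨u, hu, huf⟩ : ∃ u : ℂ, ‖u‖ = 1 ∧ (u * (f b - f a)).re = ‖f b - f a‖ := by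
    rcases eq_or_ne (f b - f a) 0 with h0 | h0
    · exact ⟨1, by simp, by simp [h0]⟩
    · have hn : ((‖f b - f a‖ : ℝ) : ℂ) ≠ 0 := by simpa using h0
      refine ⟨starRingEnd ℂ (f b - f a) / ‖f b - f a‖, ?_, ?_⟩
      · rw [norm_div, RCLike.norm_conj, Complex.norm_real, norm_norm,
          div_self (norm_ne_zero_iff.2 h0)]
      · have : starRingEnd ℂ (f b - f a) / ‖f b - f a‖ * (f b - f a) = (‖f b - f a‖ : ℝ) := by
          field_simp
          rw [Complex.mul_conj']
        rw [this, Complex.ofReal_re]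
  have hre : ∀ z : ℂ, |(u * z).re| ≤ ‖z‖ := fun z =>
    (Complex.abs_re_le_norm _).trans_eq (by rw [norm_mul, hu, one_mul])
  have hg : AbsolutelyContinuousOnInterval (fun x => (u * f x).re) a b := by
    refine hf.of_dist_le (C := 1) fun x _ y _ => ?_
    rw [one_mul, Real.dist_eq, dist_eq_norm, ← Complex.sub_re, ← mul_sub]
    exact hre _
  have := hg.sub_le_integral hab hh ?_
  · rw [← Complex.sub_re, ← mul_sub, huf] at this
    exact this
  · filter_upwards [hle] with x hx hxm
    obtain ⟨d, hd, hdh⟩ := hx hxm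
    refine ⟨(u * d).re, ?_, (le_abs_self _).trans ((hre d).trans hdh)⟩
    exact Complex.reCLM.hasFDerivAt.comp_hasDerivAt x (hd.const_mul u)

/-- Grönwall's inequality in integral form with an integrable kernel. -/
theorem le_mul_exp_of_le_add_integral {g k : ℝ → ℝ} {a b g₀ : ℝ} (hab : a ≤ b)
    (hk : IntervalIntegrable k volume a b) (hk0 : ∀ x, 0 ≤ k x)
    (hg : ContinuousOn g (Set.Icc a b))
    (hle : ∀ x ∈ Set.Icc a b, g x ≤ g₀ + ∫ t in a..x, k t * g t) :
    g b ≤ g₀ * Real.exp (∫ t in a..b, k t) := by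
  have hU : Set.uIcc a b = Set.Icc a b := Set.uIcc_of_le hab
  have hkg : IntervalIntegrable (fun t => k t * g t) volume a b :=
    hk.mul_continuousOn (by rwa [hU])
  set S : ℝ → ℝ := fun x => ∫ t in a..x, k t with hS
  set H : ℝ → ℝ := fun x => ∫ t in a..x, k t * g t with hH
  have hSac : AbsolutelyContinuousOnInterval S a b :=
    hk.absolutelyContinuousOnInterval_intervalIntegral (by simp)
  have hHac : AbsolutelyContinuousOnInterval H a b :=
    hkg.absolutelyContinuousOnInterval_intervalIntegral (by simp)
  have hH1 : AbsolutelyContinuousOnInterval (fun x => g₀ + H x) a b :=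
    hHac.of_dist_le (C := 1) fun x _ y _ => by simp
  have hS0 : ∀ x ∈ Set.Icc a b, 0 ≤ S x := fun x hx =>
    intervalIntegral.integral_nonneg hx.1 fun t _ => hk0 t
  -- `t ↦ exp (-t)` is 1-Lipschitz on `[0, ∞)`, so `exp (-S)` inherits absolute continuity from `S`.
  have hexp : ∀ s t : ℝ, 0 ≤ s → s ≤ t →
      |Real.exp (-s) - Real.exp (-t)| ≤ |s - t| := by
    intro s t hs hst
    rw [abs_of_nonneg (sub_nonneg.2 (Real.exp_le_exp.2 (by linarith))),
      abs_of_nonpos (by linarith)]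
    have h1 : Real.exp (-t) = Real.exp (-s) * Real.exp (-(t - s)) := by
      rw [← Real.exp_add]; ring_nf
    have h2 := Real.add_one_le_exp (-(t - s))
    have h3 : Real.exp (-s) ≤ 1 := Real.exp_le_one_iff.2 (by linarith)
    have h4 := Real.exp_pos (-s)
    rw [h1]
    nlinarith
  have hEac : AbsolutelyContinuousOnInterval (fun x => Real.exp (-S x)) a b := by
    refine hSac.of_dist_le (C := 1) fun x hx y hy => ?_
    rw [hU] at hx hy
    rw [one_mul, Real.dist_eq, Real.dist_eq]
    rcases le_total (S x) (S y) with h | h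
    · exact hexp _ _ (hS0 x hx) h
    · rw [abs_sub_comm, abs_sub_comm (S x)]
      exact hexp _ _ (hS0 y hy) h
  -- The derivative of `(g₀ + H) exp (-S)` is `k (g - g₀ - H) exp (-S) ≤ 0` almost everywhere, and
  -- its value at `a` is `g₀`.
  have key := (hH1.fun_mul hEac).sub_le_integral (h := fun _ => 0) hab (by simp) ?_
  · have hb := hle b ⟨hab, le_rfl⟩
    have : (g₀ + H b) * Real.exp (-S b) ≤ g₀ := by
      simpa [hS, hH] using key
    rw [Real.exp_neg, ← div_eq_mul_inv, div_le_iff₀ (Real.exp_pos _)] at this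
    exact hb.trans this
  · filter_upwards [hk.ae_hasDerivAt_integral, hkg.ae_hasDerivAt_integral] with x h1 h2 hx
    have h1 := h1 (by rwa [hU]) a (by simp)
    have h2 := h2 (by rwa [hU]) a (by simp)
    refine ⟨_, (h2.const_add g₀).mul h1.neg.exp, ?_⟩
    change k x * g x * Real.exp (-S x) + (g₀ + H x) * (Real.exp (-S x) * -k x) ≤ 0
    have h3 := mul_nonneg (mul_nonneg (hk0 x) (sub_nonneg.2 (hle x hx))) (Real.exp_pos (-S x)).le
    change 0 ≤ k x * (g₀ + H x - g x) * Real.exp (-S x) at h3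
    linarith

/-! ### Algebra of the form `[u, v]` -/

namespace SturmLiouville

/-- The bilinear form `[u, v] = p (u v' - u' v)`, for functions carried with their
quasi-derivatives. -/
def wronskian (Y Z : ℝ → ℂ × ℂ) (x : ℝ) : ℂ := (Y x).1 * (Z x).2 - (Y x).2 * (Z x).1

/-- Cramer's rule: when `[U, V] ≠ 0`, this gives the coefficients of `Y` in the basis `U, V`. -/
theorem fst_mul_wronskian (U V Y : ℝ → ℂ × ℂ) (x : ℝ) :
    (Y x).1 * wronskian U V x = (U x).1 * wronskian Y V x + (V x).1 * wronskian U Y x := by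
  unfold wronskian; ring

/-- The Plücker relation for four vectors in the plane, that is, the expansion of `Y` in `U, V`
paired with `Z`. -/
theorem wronskian_mul_wronskian (U V Y Z : ℝ → ℂ × ℂ) (x : ℝ) :
    wronskian Y Z x * wronskian U V x =
      wronskian Y V x * wronskian U Z x + wronskian U Y x * wronskian V Z x := by
  unfold wronskian; ring

theorem wronskian_add_smul_left (Y Z W : ℝ → ℂ × ℂ) (c : ℂ) (x : ℝ) :
    wronskian (Y + c • Z) W x = wronskian Y W x + c * wronskian Z W x := by
  simp [wronskian]; ring

variable {P : SturmLiouville}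

/-! ### The interval and its singular end -/

theorem left_mem_I : P.a ∈ P.I := ⟨le_rfl, P.a_lt_b⟩

theorem Icc_subset_I {c : ℝ} (hc : c ∈ P.I) : Set.Icc P.a c ⊆ P.I := fun _ hx =>
  ⟨hx.1, (EReal.coe_le_coe_iff.2 hx.2).trans_lt hc.2⟩

theorem measurableSet_I : MeasurableSet P.I :=
  measurableSet_Ici.inter (measurable_coe_real_ereal measurableSet_Iio)

theorem exists_gt_mem_I : ∃ c ∈ P.I, P.a < c := by
  obtain ⟨c, h1, h2⟩ := EReal.lt_iff_exists_real_btwn.1 P.a_lt_b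
  exact ⟨c, ⟨(EReal.coe_lt_coe_iff.1 h1).le, h2⟩, EReal.coe_lt_coe_iff.1 h1⟩

theorem atEnd_neBot : P.atEnd.NeBot := by
  refine comap_neBot fun t ht => ?_
  obtain ⟨l, hl, hlt⟩ := (mem_nhdsLT_iff_exists_Ioo_subset' P.a_lt_b).1 ht
  obtain ⟨c, h1, h2⟩ := EReal.lt_iff_exists_real_btwn.1 hl
  exact ⟨c, hlt ⟨h1, h2⟩⟩

theorem eventually_atEnd_mem {c : ℝ} (hc : c ∈ P.I) : ∀ᶠ x in P.atEnd, x ∈ P.I ∧ c ≤ x := by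
  have : Set.Ioo (c : EReal) P.b ∈ 𝓝[<] P.b := Ioo_mem_nhdsLT hc.2
  filter_upwards [preimage_mem_comap this] with x hx
  have h := EReal.coe_lt_coe_iff.1 hx.1
  exact ⟨⟨hc.1.trans h.le, hx.2⟩, h.le⟩

theorem tendsto_atEnd {u : ℕ → ℝ} (hu : ∀ n, (u n : EReal) < P.b)
    (hlim : Tendsto (fun n => (u n : EReal)) atTop (𝓝 P.b)) : Tendsto u atTop P.atEnd :=
  tendsto_comap_iff.2 (tendsto_nhdsWithin_iff.2 ⟨hlim, Eventually.of_forall hu⟩)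

theorem continuousOn_I {f : ℝ → ℂ}
    (hf : ∀ c ∈ P.I, AbsolutelyContinuousOnInterval f P.a c) : ContinuousOn f P.I := by
  intro x hx
  obtain ⟨c, hxc, hcb⟩ := EReal.lt_iff_exists_real_btwn.1 hx.2
  have hxc := EReal.coe_lt_coe_iff.1 hxc
  have hc : c ∈ P.I := ⟨hx.1.trans hxc.le, hcb⟩
  have h := (hf c hc).continuousOn x (by rw [Set.uIcc_of_le hc.1]; exact ⟨hx.1, hxc.le⟩)
  refine h.mono_of_mem_nhdsWithin ?_
  rw [Set.uIcc_of_le hc.1]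
  exact mem_nhdsWithin.2 ⟨Set.Iio c, isOpen_Iio, hxc, fun y hy => ⟨hy.2.1, hy.1.le⟩⟩

/-! ### Lagrange's identity -/

theorem HasImage.absolutelyContinuousOnInterval_wronskian {J : Set ℝ} {Y Z : ℝ → ℂ × ℂ}
    {f g : ℝ → ℂ} (hY : P.HasImage J Y f) (hZ : P.HasImage J Z g) {c : ℝ} (hc : c ∈ J) :
    AbsolutelyContinuousOnInterval (wronskian Y Z) P.a c :=
  ((hY.1 c hc).fun_smul (hZ.2.1 c hc)).fun_sub ((hY.2.1 c hc).fun_smul (hZ.1 c hc))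

/-- Lagrange's identity as an estimate for the increment of `[Y, Z]`. -/
theorem HasImage.norm_wronskian_sub_le {J : Set ℝ} {Y Z : ℝ → ℂ × ℂ} {lam mu : ℂ}
    (hY : P.HasImage J Y fun x => lam * (Y x).1) (hZ : P.HasImage J Z fun x => mu * (Z x).1)
    {c d : ℝ} (hac : P.a ≤ c) (hcd : c ≤ d) (hJ : Set.Icc P.a d ⊆ J) {h : ℝ → ℝ}
    (hh : IntervalIntegrable h volume c d)
    (hle : ∀ x ∈ Set.Icc c d, ‖(lam - mu) * (P.w x * (Y x).1 * (Z x).1)‖ ≤ h x) :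
    ‖wronskian Y Z d - wronskian Y Z c‖ ≤ ∫ x in c..d, h x := by
  have hcdJ : Set.Icc c d ⊆ J := (Set.Icc_subset_Icc_left hac).trans hJ
  have hac' := hY.absolutelyContinuousOnInterval_wronskian hZ (hJ ⟨hac.trans hcd, le_rfl⟩)
  refine (hac'.mono ?_).norm_sub_le_integral hcd hh ?_
  · rw [Set.uIcc_of_le hcd, Set.uIcc_of_le (hac.trans hcd)]
    exact Set.Icc_subset_Icc_left hac
  · have h1 := (ae_restrict_iff' measurableSet_Icc).1
        (ae_restrict_of_ae_restrict_of_subset hcdJ hY.2.2.1)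
    have h2 := (ae_restrict_iff' measurableSet_Icc).1
      (ae_restrict_of_ae_restrict_of_subset hcdJ hY.2.2.2)
    have h3 := (ae_restrict_iff' measurableSet_Icc).1
      (ae_restrict_of_ae_restrict_of_subset hcdJ hZ.2.2.1)
    have h4 := (ae_restrict_iff' measurableSet_Icc).1
      (ae_restrict_of_ae_restrict_of_subset hcdJ hZ.2.2.2)
    filter_upwards [h1, h2, h3, h4] with x h1 h2 h3 h4 hx
    refine ⟨_, ((h1 hx).mul (h4 hx)).sub ((h2 hx).mul (h3 hx)), ?_⟩
    refine le_of_eq_of_le ?_ (hle x hx)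
    congr 1
    ring

/-- For equal spectral parameters the derivative in Lagrange's identity is zero. -/
theorem HasImage.wronskian_eq {J : Set ℝ} {Y Z : ℝ → ℂ × ℂ} {lam : ℂ}
    (hY : P.HasImage J Y fun x => lam * (Y x).1) (hZ : P.HasImage J Z fun x => lam * (Z x).1)
    {d : ℝ} (had : P.a ≤ d) (hJ : Set.Icc P.a d ⊆ J) :
    wronskian Y Z d = wronskian Y Z P.a := by
  have := hY.norm_wronskian_sub_le hZ le_rfl had hJ (h := fun _ => 0) (by simp) (by simp)
  simpa [sub_eq_zero] using this

theorem HasImage.mono {J J' : Set ℝ} {Y : ℝ → ℂ × ℂ} {f : ℝ → ℂ} (hY : P.HasImage J Y f)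
    (h : J' ⊆ J) : P.HasImage J' Y f :=
  ⟨fun c hc => hY.1 c (h hc), fun c hc => hY.2.1 c (h hc),
    ae_restrict_of_ae_restrict_of_subset h hY.2.2.1,
    ae_restrict_of_ae_restrict_of_subset h hY.2.2.2⟩

/-- A solution whose first component vanishes identically vanishes at `a`. -/
theorem IsSolution.apply_left_eq_zero {lam : ℂ} {Y : ℝ → ℂ × ℂ} (hY : P.IsSolution lam Y)
    (h0 : ∀ x ∈ P.I, (Y x).1 = 0) : Y P.a = 0 := by
  obtain ⟨c, hc, hac⟩ := P.exists_gt_mem_I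
  refine Prod.ext (h0 _ left_mem_I) ?_
  have hsub := Icc_subset_I hc
  have hcont := hY.2.1 c hc |>.continuousOn
  rw [Set.uIcc_of_le hac.le] at hcont
  refine Measure.eqOn_Icc_of_ae_eq (μ := volume) hac.ne ?_ hcont
    (continuousOn_const (c := (0 : ℂ))) ⟨le_rfl, hac.le⟩
  have h1 := (ae_restrict_iff' measurableSet_Icc).1
    (ae_restrict_of_ae_restrict_of_subset hsub hY.2.2.1)
  have h2 := (ae_restrict_iff' measurableSet_Icc).1
    (ae_restrict_of_ae_restrict_of_subset hsub P.p_ne)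
  -- At interior points `y` vanishes on a full neighbourhood, so `y' = 0` there; `p ≠ 0` then forces
  -- `p y' = 0` almost everywhere, and continuity extends this to `a`.
  rw [EventuallyEq, ← restrict_Ioo_eq_restrict_Icc, ae_restrict_iff' measurableSet_Ioo]
  filter_upwards [h1, h2] with x h1 h2 hx
  have hx' := Set.Ioo_subset_Icc_self hx
  have hz : HasDerivAt (fun t => (Y t).1) 0 x := by
    refine (hasDerivAt_const x (0 : ℂ)).congr_of_eventuallyEq ?_
    filter_upwards [Icc_mem_nhds hx.1 hx.2] with t ht using h0 t (hsub ht)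
  exact (div_eq_zero_iff.1 ((h1 hx').unique hz)).resolve_right (h2 hx')

/-! ### Domination by two square-integrable functions -/

/-- The density `|w| (|u| + |v|)²` attached to two functions `u, v`. -/
noncomputable def density (P : SturmLiouville) (U V : ℝ → ℂ × ℂ) (x : ℝ) : ℝ :=
  |P.w x| * (‖(U x).1‖ + ‖(V x).1‖) ^ 2

theorem density_nonneg (U V : ℝ → ℂ × ℂ) (x : ℝ) : 0 ≤ P.density U V x := by
  unfold density; positivity

theorem integrableOn_density {U V : ℝ → ℂ × ℂ} (hU : P.L2w P.I fun x => (U x).1)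
    (hV : P.L2w P.I fun x => (V x).1) : IntegrableOn (P.density U V) P.I := by
  have hw : AEStronglyMeasurable P.w (volume.restrict P.I) := P.w_loc.aestronglyMeasurable
  -- The factor 2 comes from `(s + t)² ≤ 2 (s² + t²)`.
  refine ((hU.2.norm.add hV.2.norm).const_mul 2).mono' ?_ (Eventually.of_forall fun x => ?_)
  · exact hw.norm.mul ((hU.1.norm.add hV.1.norm).pow 2)
  · rw [Real.norm_of_nonneg (density_nonneg U V x)]
    simp only [density, Pi.add_apply, norm_mul, Real.norm_eq_abs, abs_pow, abs_norm]
    nlinarith [mul_nonneg (abs_nonneg (P.w x)) (sq_nonneg (‖(U x).1‖ - ‖(V x).1‖))]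

theorem IsSolution.l2w_of_norm_le {U V Y : ℝ → ℂ × ℂ} {lam : ℂ} (hY : P.IsSolution lam Y)
    (hs : IntegrableOn (P.density U V) P.I) {C : ℝ}
    (hC : ∀ x ∈ P.I, ‖(Y x).1‖ ≤ C * (‖(U x).1‖ + ‖(V x).1‖)) :
    P.L2w P.I fun x => (Y x).1 := by
  have hw : AEStronglyMeasurable P.w (volume.restrict P.I) := P.w_loc.aestronglyMeasurable
  have hm : AEStronglyMeasurable (fun x => (Y x).1) (volume.restrict P.I) :=
    (continuousOn_I hY.1).aestronglyMeasurable measurableSet_I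
  refine ⟨hm, (hs.const_mul (C ^ 2)).mono' (hw.mul (hm.norm.pow 2)) ?_⟩
  rw [ae_restrict_iff' measurableSet_I]
  refine Eventually.of_forall fun x hx => ?_
  have h := pow_le_pow_left₀ (norm_nonneg _) (hC x hx) 2
  rw [norm_mul, norm_pow, norm_norm, Real.norm_eq_abs, density]
  calc |P.w x| * ‖(Y x).1‖ ^ 2 ≤ |P.w x| * (C * (‖(U x).1‖ + ‖(V x).1‖)) ^ 2 := by gcongr
    _ = _ := by ring

theorem intervalIntegrable_of_integrableOn_I {s : ℝ → ℝ} (hs : IntegrableOn s P.I) {c d : ℝ}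
    (hc : c ∈ P.I) (hd : d ∈ P.I) : IntervalIntegrable s volume c d := by
  refine IntegrableOn.intervalIntegrable (hs.mono_set ?_)
  intro x hx
  rcases le_total c d with h | h
  · rw [Set.uIcc_of_le h] at hx
    exact Icc_subset_I hd ⟨hc.1.trans hx.1, hx.2⟩
  · rw [Set.uIcc_of_ge h] at hx
    exact Icc_subset_I hc ⟨hd.1.trans hx.1, hx.2⟩

theorem intervalIntegral_le_setIntegral_I {s : ℝ → ℝ} (hs : IntegrableOn s P.I)
    (h0 : ∀ x, 0 ≤ s x) {d : ℝ} (hd : d ∈ P.I) :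
    ∫ x in P.a..d, s x ≤ ∫ x in P.I, s x := by
  rw [intervalIntegral.integral_of_le hd.1]
  refine setIntegral_mono_set hs (Eventually.of_forall h0) (LE.le.eventuallyLE ?_)
  exact Set.Ioc_subset_Icc_self.trans (Icc_subset_I hd)

/-! ### Limits at the singular end -/

/-- The integrals over `[a, x]` of a nonnegative integrable function increase to a limit as
`x → b`. -/
theorem exists_tendsto_intervalIntegral {s : ℝ → ℝ} (hs : IntegrableOn s P.I)
    (h0 : ∀ x, 0 ≤ s x) :
    ∃ L, Tendsto (fun x => ∫ t in P.a..x, s t) P.atEnd (𝓝 L) := by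
  set S : ℝ → ℝ := fun x => ∫ t in P.a..x, s t
  have hbdd : BddAbove (S '' P.I) :=
    ⟨∫ x in P.I, s x, by rintro _ ⟨x, hx, rfl⟩; exact intervalIntegral_le_setIntegral_I hs h0 hx⟩
  have hmono : ∀ c ∈ P.I, ∀ d ∈ P.I, c ≤ d → S c ≤ S d := fun c hc d hd hcd => by
    have h1 := intervalIntegral.integral_interval_sub_left
      (intervalIntegrable_of_integrableOn_I hs left_mem_I hd)
      (intervalIntegrable_of_integrableOn_I hs left_mem_I hc)
    have h2 : 0 ≤ ∫ t in c..d, s t := intervalIntegral.integral_nonneg hcd fun t _ => h0 t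
    simp only [S]; linarith
  refine ⟨sSup (S '' P.I), tendsto_order.2 ⟨fun l hl => ?_, fun u hu => ?_⟩⟩
  · obtain ⟨_, ⟨c, hc, rfl⟩, hlc⟩ := exists_lt_of_lt_csSup (Set.Nonempty.image S ⟨P.a, left_mem_I⟩) hl
    filter_upwards [eventually_atEnd_mem hc] with x hx
    exact hlc.trans_le (hmono c hc x hx.1 hx.2)
  · filter_upwards [eventually_atEnd_mem (P := P) left_mem_I] with x hx
    exact (le_csSup hbdd ⟨x, hx.1, rfl⟩).trans_lt hu

/-- A function whose increments are controlled by those of a function with a limit at `b` has a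
limit at `b`, with the corresponding rate. -/
theorem exists_tendsto_of_norm_sub_le {S : ℝ → ℝ} {L B : ℝ} (hS : Tendsto S P.atEnd (𝓝 L))
    {W : ℝ → ℂ}
    (hW : ∀ c ∈ P.I, ∀ d ∈ P.I, c ≤ d → ‖W d - W c‖ ≤ B * (S d - S c)) :
    ∃ z, Tendsto W P.atEnd (𝓝 z) ∧ ∀ c ∈ P.I, ‖z - W c‖ ≤ B * (L - S c) := by
  have := P.atEnd_neBot
  have hI : ∀ᶠ x in P.atEnd, x ∈ P.I := (eventually_atEnd_mem left_mem_I).mono fun _ h => h.1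
  have hcau : Cauchy (map W P.atEnd) := by
    refine cauchy_map_iff.2 ⟨this, tendsto_uniformity_iff_dist_tendsto_zero.2 ?_⟩
    have hlim : Tendsto (fun p : ℝ × ℝ => |B| * dist (S p.1) (S p.2)) (P.atEnd ×ˢ P.atEnd)
        (𝓝 0) := by
      simpa using ((hS.comp tendsto_fst).dist (hS.comp tendsto_snd)).const_mul |B|
    refine squeeze_zero' (Eventually.of_forall fun _ => dist_nonneg) ?_ hlim
    filter_upwards [hI.prod_mk hI] with p hp
    have hle : ∀ c ∈ P.I, ∀ d ∈ P.I, c ≤ d → dist (W d) (W c) ≤ |B| * dist (S d) (S c) :=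
      fun c hc d hd hcd => by
        rw [dist_eq_norm, Real.dist_eq, ← abs_mul]
        exact (hW c hc d hd hcd).trans (le_abs_self _)
    rcases le_total p.1 p.2 with h | h
    · rw [dist_comm, dist_comm (S p.1)]
      exact hle _ hp.1 _ hp.2 h
    · exact hle _ hp.2 _ hp.1 h
  obtain ⟨z, hz⟩ := cauchy_map_iff_exists_tendsto.1 hcau
  refine ⟨z, hz, fun c hc => ?_⟩
  refine le_of_tendsto_of_tendsto (hz.sub_const _).norm ((hS.sub_const _).const_mul B) ?_
  filter_upwards [eventually_atEnd_mem hc] with x hx using hW c hc x hx.1 hx.2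

/-- The two domination bounds multiply to `C C'` times the density in Lagrange's identity. The
result has the form required by `exists_tendsto_of_norm_sub_le`, with a constant depending on the
solutions only through `C`, `C'` and the parameters. -/
theorem IsSolution.norm_wronskian_sub_le {U V Y Z : ℝ → ℂ × ℂ} {lam mu : ℂ}
    (hY : P.IsSolution lam Y) (hZ : P.IsSolution mu Z)
    (hs : IntegrableOn (P.density U V) P.I) {C C' : ℝ} (hC0 : 0 ≤ C)
    (hC : ∀ x ∈ P.I, ‖(Y x).1‖ ≤ C * (‖(U x).1‖ + ‖(V x).1‖))
    (hC' : ∀ x ∈ P.I, ‖(Z x).1‖ ≤ C' * (‖(U x).1‖ + ‖(V x).1‖))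
    {c d : ℝ} (hc : c ∈ P.I) (hd : d ∈ P.I) (hcd : c ≤ d) :
    ‖wronskian Y Z d - wronskian Y Z c‖ ≤ ‖lam - mu‖ * (C * C') *
      ((∫ x in P.a..d, P.density U V x) - ∫ x in P.a..c, P.density U V x) := by
  rw [intervalIntegral.integral_interval_sub_left
      (intervalIntegrable_of_integrableOn_I hs left_mem_I hd)
      (intervalIntegrable_of_integrableOn_I hs left_mem_I hc),
    ← intervalIntegral.integral_const_mul]
  refine HasImage.norm_wronskian_sub_le hY hZ hc.1 hcd (Icc_subset_I hd)
    ((intervalIntegrable_of_integrableOn_I hs hc hd).const_mul _) fun x hx => ?_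
  have hx' := Icc_subset_I hd ⟨hc.1.trans hx.1, hx.2⟩
  rw [norm_mul, norm_mul, norm_mul, Complex.norm_real, Real.norm_eq_abs, density]
  calc ‖lam - mu‖ * (|P.w x| * ‖(Y x).1‖ * ‖(Z x).1‖)
      ≤ ‖lam - mu‖ * (|P.w x| * (C * (‖(U x).1‖ + ‖(V x).1‖)) *
          (C' * (‖(U x).1‖ + ‖(V x).1‖))) := by
        gcongr
        exacts [hC x hx', hC' x hx']
    _ = _ := by ring

/-! ### Uniform bounds and uniform convergence in the spectral parameter -/

/-- Variation of constants: every solution at `lam` is dominated by two independent solutions at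
`lam₁`, uniformly for bounded `lam`, if the latter lie in `L²_w`. -/
theorem IsSolution.norm_fst_le {U V Y : ℝ → ℂ × ℂ} {lam₁ lam : ℂ} {R : ℝ}
    (hU : P.IsSolution lam₁ U) (hV : P.IsSolution lam₁ V) (hY : P.IsSolution lam Y)
    (hUV : wronskian U V P.a = -1) (hs : IntegrableOn (P.density U V) P.I)
    (hR : ‖lam - lam₁‖ ≤ R) {x : ℝ} (hx : x ∈ P.I) :
    ‖(Y x).1‖ ≤ (‖wronskian Y V P.a‖ + ‖wronskian U Y P.a‖) *
      Real.exp (2 * R * ∫ t in P.I, P.density U V t) * (‖(U x).1‖ + ‖(V x).1‖) := by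
  have hR0 : 0 ≤ R := (norm_nonneg _).trans hR
  set g : ℝ → ℝ := fun x => ‖wronskian Y V x‖ + ‖wronskian U Y x‖ with hg
  have hYle : ∀ x ∈ P.I, ‖(Y x).1‖ ≤ g x * (‖(U x).1‖ + ‖(V x).1‖) := by
    intro x hx
    have h1 := HasImage.wronskian_eq hU hV hx.1 (Icc_subset_I hx)
    have h2 := fst_mul_wronskian U V Y x
    rw [h1, hUV] at h2
    have h3 : ‖(Y x).1‖ = ‖(U x).1 * wronskian Y V x + (V x).1 * wronskian U Y x‖ := by
      rw [← h2]; simp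
    rw [h3]
    refine (norm_add_le _ _).trans ?_
    rw [norm_mul, norm_mul, hg]
    nlinarith [norm_nonneg (U x).1, norm_nonneg (V x).1, norm_nonneg (wronskian Y V x),
      norm_nonneg (wronskian U Y x), mul_nonneg (norm_nonneg (U x).1) (norm_nonneg (wronskian U Y x)),
      mul_nonneg (norm_nonneg (V x).1) (norm_nonneg (wronskian Y V x))]
  have hgc : ContinuousOn g P.I :=
    ((continuousOn_I fun c hc => hY.absolutelyContinuousOnInterval_wronskian hV hc).norm).add
      ((continuousOn_I fun c hc => hU.absolutelyContinuousOnInterval_wronskian hY hc).norm)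
  -- The coefficients `[Y, V]` and `[U, Y]` each grow by at most the integral of `R * density * g`;
  -- their sum gives the Grönwall kernel `2 * R * density`.
  have hgx : g x ≤ g P.a * Real.exp (∫ t in P.a..x, 2 * R * P.density U V t) := by
    refine le_mul_exp_of_le_add_integral hx.1
      ((intervalIntegrable_of_integrableOn_I hs left_mem_I hx).const_mul _)
      (fun t => mul_nonneg (by positivity) (density_nonneg U V t))
      (hgc.mono (Icc_subset_I hx)) fun y hy => ?_
    have hyI := Icc_subset_I hx hy
    have hint : IntervalIntegrable (fun t => R * P.density U V t * g t) volume P.a y := by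
      refine ((intervalIntegrable_of_integrableOn_I hs left_mem_I hyI).const_mul R).mul_continuousOn
        (hgc.mono ?_)
      rw [Set.uIcc_of_le hy.1]
      exact Icc_subset_I hyI
    have hbound : ∀ t ∈ P.I, ∀ z : ℂ, ‖z‖ ≤ ‖(U t).1‖ + ‖(V t).1‖ →
        ‖lam - lam₁‖ * (|P.w t| * ‖(Y t).1‖ * ‖z‖) ≤ R * P.density U V t * g t := by
      intro t ht z hz
      have hg0 : 0 ≤ g t := by positivity
      calc ‖lam - lam₁‖ * (|P.w t| * ‖(Y t).1‖ * ‖z‖)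
          ≤ R * (|P.w t| * (g t * (‖(U t).1‖ + ‖(V t).1‖)) * (‖(U t).1‖ + ‖(V t).1‖)) := by
            gcongr
            exact hYle t ht
        _ = _ := by rw [density]; ring
    have h1 := HasImage.norm_wronskian_sub_le hY hV le_rfl hy.1 (Icc_subset_I hyI) hint
      fun t ht => by
        rw [norm_mul, norm_mul, norm_mul, Complex.norm_real, Real.norm_eq_abs]
        exact hbound t (Icc_subset_I hyI ht) _ (by simp)
    have h2 := HasImage.norm_wronskian_sub_le hU hY le_rfl hy.1 (Icc_subset_I hyI) hint
      fun t ht => by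
        rw [norm_mul, norm_mul, norm_mul, Complex.norm_real, Real.norm_eq_abs, norm_sub_rev,
          mul_right_comm]
        exact hbound t (Icc_subset_I hyI ht) _ (by simp)
    have h3 : ∫ t in P.a..y, 2 * R * P.density U V t * g t =
        2 * ∫ t in P.a..y, R * P.density U V t * g t := by
      rw [← intervalIntegral.integral_const_mul]
      congr 1; ext t; ring
    have h4 := norm_le_norm_add_norm_sub' (wronskian Y V y) (wronskian Y V P.a)
    have h5 := norm_le_norm_add_norm_sub' (wronskian U Y y) (wronskian U Y P.a)
    rw [h3]
    simp only [hg] at *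
    linarith
  refine (hYle x hx).trans ?_
  gcongr
  refine hgx.trans ?_
  rw [intervalIntegral.integral_const_mul]
  have := intervalIntegral_le_setIntegral_I hs (density_nonneg U V) hx
  gcongr

/-- For a family of solutions with fixed initial values, the form `[Y lam, ψ]` has a limit at `b`
which is attained uniformly and is continuous on sets of `lam` on which the family is uniformly
dominated. -/
theorem exists_tendstoUniformlyOn_wronskian {U V ψ : ℝ → ℂ × ℂ} {lam' : ℂ}
    {θ φ Y : ℂ → ℝ → ℂ × ℂ} {y₀ : ℂ × ℂ} {𝒦 : Set ℂ} (h𝒦 : Bornology.IsBounded 𝒦) {C C' : ℝ}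
    (hC0 : 0 ≤ C) (hC'0 : 0 ≤ C')
    (hs : IntegrableOn (P.density U V) P.I)
    (hθ : ∀ lam, P.IsSolution lam (θ lam)) (hφ : ∀ lam, P.IsSolution lam (φ lam))
    (hY : ∀ lam, P.IsSolution lam (Y lam)) (hψ : P.IsSolution lam' ψ)
    (hY0 : ∀ lam, Y lam P.a = y₀) (hW : ∀ lam, wronskian (θ lam) (φ lam) P.a = -1)
    (hCθ : ∀ lam ∈ 𝒦, ∀ x ∈ P.I, ‖(θ lam x).1‖ ≤ C * (‖(U x).1‖ + ‖(V x).1‖))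
    (hCφ : ∀ lam ∈ 𝒦, ∀ x ∈ P.I, ‖(φ lam x).1‖ ≤ C * (‖(U x).1‖ + ‖(V x).1‖))
    (hCY : ∀ lam ∈ 𝒦, ∀ x ∈ P.I, ‖(Y lam x).1‖ ≤ C * (‖(U x).1‖ + ‖(V x).1‖))
    (hCψ : ∀ x ∈ P.I, ‖(ψ x).1‖ ≤ C' * (‖(U x).1‖ + ‖(V x).1‖))
    {bn : ℕ → ℝ} (hbn : ∀ n, bn n ∈ P.I) (hlim : Tendsto bn atTop P.atEnd) :
    ∃ F : ℂ → ℂ, (∀ lam ∈ 𝒦, Tendsto (wronskian (Y lam) ψ) P.atEnd (𝓝 (F lam))) ∧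
      TendstoUniformlyOn (fun n lam => wronskian (Y lam) ψ (bn n)) F atTop 𝒦 ∧
      ContinuousOn F 𝒦 := by
  obtain ⟨L, hL⟩ := exists_tendsto_intervalIntegral hs (density_nonneg U V)
  have hex : ∀ lam ∈ 𝒦, ∃ z, Tendsto (wronskian (Y lam) ψ) P.atEnd (𝓝 z) ∧ ∀ c ∈ P.I,
      ‖z - wronskian (Y lam) ψ c‖ ≤
        ‖lam - lam'‖ * (C * C') * (L - ∫ t in P.a..c, P.density U V t) :=
    fun lam hlam => exists_tendsto_of_norm_sub_le hL fun c hc d hd hcd =>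
      (hY lam).norm_wronskian_sub_le hψ hs hC0 (hCY lam hlam) hCψ hc hd hcd
  choose! F hF hFle using hex
  obtain ⟨R, hR⟩ : ∃ R, ∀ lam ∈ 𝒦, ‖lam - lam'‖ ≤ R := by
    obtain ⟨R, hR⟩ := h𝒦.subset_closedBall lam'
    exact ⟨R, fun lam hlam => by simpa [dist_eq_norm] using hR hlam⟩
  have hunif : TendstoUniformlyOn (fun n lam => wronskian (Y lam) ψ (bn n)) F atTop 𝒦 := by
    have hz : Tendsto (fun n => R * (C * C') * |L - ∫ t in P.a..bn n, P.density U V t|) atTop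
        (𝓝 0) := by
      simpa using (((hL.comp hlim).const_sub L).abs).const_mul (R * (C * C'))
    refine Metric.tendstoUniformlyOn_iff.2 fun ε hε => ?_
    filter_upwards [hz.eventually_lt_const hε] with n hn lam hlam
    rw [dist_eq_norm]
    refine lt_of_le_of_lt (hFle lam hlam _ (hbn n)) (lt_of_le_of_lt ?_ hn)
    refine (mul_le_mul_of_nonneg_left (le_abs_self _) (by positivity)).trans ?_
    have := hR lam hlam
    gcongr
  -- A uniform limit of continuous functions is continuous, so it remains to prove continuity in
  -- `lam` at a fixed point `bn n`.
  refine ⟨F, hF, hunif, hunif.continuousOn (Frequently.of_forall fun n => ?_)⟩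
  intro mu hmu
  set x := bn n
  set T := ∫ t in P.a..x, P.density U V t with hT
  have hx : x ∈ P.I := hbn n
  -- Expand `Y lam` and `Y mu` in the basis `θ mu, φ mu`. The coefficients agree at `a`; those of `Y
  -- mu` stay constant, while those of `Y lam` drift by `O(‖lam - mu‖)` by Lagrange's identity.
  have hconst : ∀ lam ∈ 𝒦, ‖wronskian (Y lam) ψ x - wronskian (Y mu) ψ x‖ ≤
      ‖lam - mu‖ * (C * C * T * (‖wronskian (θ mu) ψ x‖ + ‖wronskian (φ mu) ψ x‖)) := by
    intro lam hlam
    have e1 := wronskian_mul_wronskian (θ mu) (φ mu) (Y lam) ψ x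
    have e2 := wronskian_mul_wronskian (θ mu) (φ mu) (Y mu) ψ x
    rw [HasImage.wronskian_eq (hθ mu) (hφ mu) hx.1 (Icc_subset_I hx), hW] at e1 e2
    have e3 := HasImage.wronskian_eq (hY mu) (hφ mu) hx.1 (Icc_subset_I hx)
    have e4 := HasImage.wronskian_eq (hθ mu) (hY mu) hx.1 (Icc_subset_I hx)
    have e5 : wronskian (Y mu) (φ mu) P.a = wronskian (Y lam) (φ mu) P.a := by
      simp [wronskian, hY0]
    have e6 : wronskian (θ mu) (Y mu) P.a = wronskian (θ mu) (Y lam) P.a := by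
      simp [wronskian, hY0]
    rw [e3, e4, e5, e6] at e2
    have b1 := (hY lam).norm_wronskian_sub_le (hφ mu) hs hC0 (hCY lam hlam) (hCφ mu hmu)
      left_mem_I hx hx.1
    have b2 := (hθ mu).norm_wronskian_sub_le (hY lam) hs hC0 (hCθ mu hmu) (hCY lam hlam)
      left_mem_I hx hx.1
    rw [intervalIntegral.integral_same, sub_zero, ← hT] at b1 b2
    rw [norm_sub_rev mu lam] at b2
    have e7 : wronskian (Y lam) ψ x - wronskian (Y mu) ψ x =
        -((wronskian (Y lam) (φ mu) x - wronskian (Y lam) (φ mu) P.a) * wronskian (θ mu) ψ x +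
          (wronskian (θ mu) (Y lam) x - wronskian (θ mu) (Y lam) P.a) * wronskian (φ mu) ψ x) := by
      linear_combination e2 - e1
    rw [e7, norm_neg]
    refine (norm_add_le _ _).trans ?_
    rw [norm_mul, norm_mul]
    calc _ ≤ ‖lam - mu‖ * (C * C) * T * ‖wronskian (θ mu) ψ x‖ +
        ‖lam - mu‖ * (C * C) * T * ‖wronskian (φ mu) ψ x‖ := by gcongr
      _ = _ := by ring
  rw [ContinuousWithinAt, tendsto_iff_norm_sub_tendsto_zero]
  refine squeeze_zero' (Eventually.of_forall fun _ => norm_nonneg _)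
    (eventually_nhdsWithin_of_forall hconst) ?_
  have hc : Continuous fun lam : ℂ => ‖lam - mu‖ *
      (C * C * T * (‖wronskian (θ mu) ψ x‖ + ‖wronskian (φ mu) ψ x‖)) := by fun_prop
  simpa using (hc.tendsto mu).mono_left nhdsWithin_le_nhds

/-! ### Solutions satisfying the boundary conditions -/

theorem IsSolution.add_smul {lam : ℂ} {Y Z : ℝ → ℂ × ℂ} (hY : P.IsSolution lam Y)
    (hZ : P.IsSolution lam Z) (c : ℂ) : P.IsSolution lam (Y + c • Z) := by
  refine ⟨fun d hd => (hY.1 d hd).fun_add ((hZ.1 d hd).const_smul c),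
    fun d hd => (hY.2.1 d hd).fun_add ((hZ.2.1 d hd).const_smul c), ?_, ?_⟩
  · filter_upwards [hY.2.2.1, hZ.2.2.1] with x h1 h2
    convert! h1.add (h2.const_smul c) using 1
    simp
    ring
  · filter_upwards [hY.2.2.2, hZ.2.2.2] with x h1 h2
    convert! h1.add (h2.const_smul c) using 1
    simp
    ring

/-- A solution satisfying the boundary condition at `a` is a multiple of `φ`, so that an
eigenvalue of the regular problem on `[a, c]` is a zero of `[φ, ψ](c)`. -/
theorem not_isEigenvalueReg_of_wronskian_ne_zero {α lam : ℂ} {ψ Θ Φ : ℝ → ℂ × ℂ} {c : ℝ}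
    (hc : c ∈ P.I) (hΘ : P.IsSolution lam Θ) (hΦ : P.IsSolution lam Φ)
    (hΘ0 : Θ P.a = (Complex.cos α, Complex.sin α))
    (hΦ0 : Φ P.a = (Complex.sin α, -Complex.cos α)) (h : wronskian Φ ψ c ≠ 0) :
    ¬ P.IsEigenvalueReg α ψ c lam := by
  rintro ⟨Y, ⟨hY, -, -, hYa, hYc⟩, x, hx, hYx⟩
  have hsub := Icc_subset_I hc
  have hΘ' := HasImage.mono hΘ hsub
  have hΦ' := HasImage.mono hΦ hsub
  have hsc := Complex.sin_sq_add_cos_sq α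
  have hIcc : ∀ {t}, t ∈ Set.Icc P.a c → Set.Icc P.a t ⊆ Set.Icc P.a c := fun ht =>
    Set.Icc_subset_Icc_right ht.2
  have hΘΦ : ∀ t ∈ Set.Icc P.a c, wronskian Θ Φ t = -1 := fun t ht => by
    rw [hΘ'.wronskian_eq hΦ' ht.1 (hIcc ht)]
    simp only [wronskian, hΘ0, hΦ0]
    linear_combination -hsc
  have hYΦ : ∀ t ∈ Set.Icc P.a c, wronskian Y Φ t = 0 := fun t ht => by
    rw [hY.wronskian_eq hΦ' ht.1 (hIcc ht)]
    simp only [wronskian, hΦ0]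
    linear_combination -hYa
  have hΘY : ∀ t ∈ Set.Icc P.a c, wronskian Θ Y t = wronskian Θ Y P.a := fun t ht =>
    hΘ'.wronskian_eq hY ht.1 (hIcc ht)
  have hcm : c ∈ Set.Icc P.a c := ⟨hc.1, le_rfl⟩
  -- The condition at `a` has removed the coefficient `[Y, Φ]`. With `[Y, ψ](c) = 0` the relation
  -- reduces to `[Θ, Y] [Φ, ψ](c) = 0`, which removes the other one.
  have h1 := wronskian_mul_wronskian Θ Φ Y ψ c
  have hYψ : wronskian Y ψ c = 0 := hYc
  rw [hYΦ c hcm, hΘY c hcm, hYψ, zero_mul, zero_mul, zero_add] at h1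
  have h2 := (mul_eq_zero.1 h1.symm).resolve_right h
  have h3 := fst_mul_wronskian Θ Φ Y x
  rw [hΘΦ x hx, hYΦ x hx, hΘY x hx, h2] at h3
  exact hYx (by linear_combination -h3)

end SturmLiouville

open SturmLiouville

/-! ### Convergence of the Titchmarsh–Weyl functions -/

theorem mainTheorem7 (P : SturmLiouville)
    (α : ℂ) (η : ℝ) (K : ℂ) (hS : P.AdmissibleAt α η K)
    (lam₁ : ℂ) (hlam₁ : ((lam₁ - K) * Complex.exp (Complex.I * η)).re ≤ 0)
    (hcase : P.SimsCaseII η K lam₁ ∨ P.SimsCaseIII η K lam₁)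
    (θ φ : ℂ → ℝ → ℂ × ℂ)
    (hθ : ∀ lam, P.IsSolution lam (θ lam) ∧ θ lam P.a = (Complex.cos α, Complex.sin α))
    (hφ : ∀ lam, P.IsSolution lam (φ lam) ∧ φ lam P.a = (Complex.sin α, -Complex.cos α))
    (lam' : ℂ) (hlam' : ((lam' - K) * Complex.exp (Complex.I * η)).re ≤ 0)
    (m : ℂ → ℂ) (ψ : ℝ → ℂ × ℂ) (hψ : ψ = θ lam' + m lam' • φ lam')
    (hm : ∀ lam, ¬ P.IsEigenvalueM α ψ lam → P.IsWeylValue ψ (θ lam) (φ lam) (m lam))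
    (bn : ℕ → ℝ) (hbn_mono : Monotone bn) (hbn : ∀ n, P.a < bn n ∧ (bn n : EReal) < P.b)
    (hbn_lim : Tendsto (fun n => (bn n : EReal)) atTop (𝓝 P.b))
    (mn : ℕ → ℂ → ℂ)
    (hmn : ∀ n lam, ¬ P.IsEigenvalueReg α ψ (bn n) lam →
      IsRegWeylValue ψ (θ lam) (φ lam) (bn n) (mn n lam))
    (𝒦 : Set ℂ) (h𝒦 : IsCompact 𝒦) (h𝒦_eig : ∀ lam ∈ 𝒦, ¬ P.IsEigenvalueM α ψ lam) :
    (∀ lam ∈ 𝒦, ∃! μ, P.IsWeylValue ψ (θ lam) (φ lam) μ) ∧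
    (∀ᶠ n in atTop, ∀ lam ∈ 𝒦, ¬ P.IsEigenvalueReg α ψ (bn n) lam ∧
      ∃! μ, IsRegWeylValue ψ (θ lam) (φ lam) (bn n) μ) ∧
    TendstoUniformlyOn mn m atTop 𝒦 := by
  have := P.atEnd_neBot
  have hsc := Complex.sin_sq_add_cos_sq α
  have hall : ∀ Y, P.IsSolution lam₁ Y → P.L2w P.I (fun x => (Y x).1) := by
    rcases hcase with h | h
    · exact h.2
    · exact fun Y hY => (h Y hY).1
  have hW : ∀ lam mu, wronskian (θ lam) (φ mu) P.a = -1 := fun lam mu => by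
    simp only [wronskian, (hθ lam).2, (hφ mu).2]
    linear_combination -hsc
  have hs := integrableOn_density (hall _ (hθ lam₁).1) (hall _ (hφ lam₁).1)
  -- the solutions are dominated by those at `lam₁`, uniformly for bounded `lam`
  have hdom : ∀ R, ∃ C, 0 ≤ C ∧ ∀ lam, ‖lam - lam₁‖ ≤ R → ∀ x ∈ P.I,
      ‖(θ lam x).1‖ ≤ C * (‖(θ lam₁ x).1‖ + ‖(φ lam₁ x).1‖) ∧
      ‖(φ lam x).1‖ ≤ C * (‖(θ lam₁ x).1‖ + ‖(φ lam₁ x).1‖) := by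
    intro R
    -- The exponential alone serves as `C`: for `θ lam` and for `φ lam`, the initial coefficients
    -- with respect to `θ lam₁, φ lam₁` have moduli 0 and 1.
    refine ⟨_, (Real.exp_pos (2 * R * ∫ t in P.I, P.density (θ lam₁) (φ lam₁) t)).le,
      fun lam hlam x hx => ⟨?_, ?_⟩⟩
    · have h := IsSolution.norm_fst_le (hθ lam₁).1 (hφ lam₁).1 (hθ lam).1 (hW _ _) hs hlam hx
      have h0 : wronskian (θ lam₁) (θ lam) P.a = 0 := by
        simp only [wronskian, (hθ _).2]; ring
      simpa [hW, h0] using h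
    · have h := IsSolution.norm_fst_le (hθ lam₁).1 (hφ lam₁).1 (hφ lam).1 (hW _ _) hs hlam hx
      have h0 : wronskian (φ lam) (φ lam₁) P.a = 0 := by
        simp only [wronskian, (hφ _).2]; ring
      simpa [hW, h0] using h
  have hψsol : P.IsSolution lam' ψ := hψ ▸ (hθ lam').1.add_smul (hφ lam').1 _
  obtain ⟨C', hC'0, hCψ⟩ : ∃ C', 0 ≤ C' ∧
      ∀ x ∈ P.I, ‖(ψ x).1‖ ≤ C' * (‖(θ lam₁ x).1‖ + ‖(φ lam₁ x).1‖) := by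
    obtain ⟨C, hC0, hC⟩ := hdom ‖lam' - lam₁‖
    refine ⟨C + ‖m lam'‖ * C, by positivity, fun x hx => ?_⟩
    obtain ⟨h1, h2⟩ := hC lam' le_rfl x hx
    have h3 : ‖(ψ x).1‖ ≤ ‖(θ lam' x).1‖ + ‖m lam'‖ * ‖(φ lam' x).1‖ := by
      rw [hψ, ← norm_mul]
      exact norm_add_le _ _
    have h4 := mul_le_mul_of_nonneg_left h2 (norm_nonneg (m lam'))
    linarith
  obtain ⟨C, hC0, hC⟩ : ∃ C, 0 ≤ C ∧ ∀ lam ∈ 𝒦, ∀ x ∈ P.I,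
      ‖(θ lam x).1‖ ≤ C * (‖(θ lam₁ x).1‖ + ‖(φ lam₁ x).1‖) ∧
      ‖(φ lam x).1‖ ≤ C * (‖(θ lam₁ x).1‖ + ‖(φ lam₁ x).1‖) := by
    obtain ⟨R, hR⟩ := h𝒦.isBounded.subset_closedBall lam₁
    obtain ⟨C, hC0, hC⟩ := hdom R
    exact ⟨C, hC0, fun lam hlam => hC lam (by simpa [dist_eq_norm] using hR hlam)⟩
  have hCθ := fun lam hlam x hx => (hC lam hlam x hx).1
  have hCφ := fun lam hlam x hx => (hC lam hlam x hx).2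
  have hbI : ∀ n, bn n ∈ P.I := fun n => ⟨(hbn n).1.le, (hbn n).2⟩
  have hbE := P.tendsto_atEnd (fun n => (hbn n).2) hbn_lim
  obtain ⟨G, hG, hGu, hGc⟩ := exists_tendstoUniformlyOn_wronskian h𝒦.isBounded hC0 hC'0 hs
    (fun lam => (hθ lam).1) (fun lam => (hφ lam).1) (fun lam => (hθ lam).1) hψsol
    (fun lam => (hθ lam).2) (fun lam => hW lam lam) hCθ hCφ hCθ hCψ hbI hbE
  obtain ⟨F, hF, hFu, hFc⟩ := exists_tendstoUniformlyOn_wronskian h𝒦.isBounded hC0 hC'0 hs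
    (fun lam => (hθ lam).1) (fun lam => (hφ lam).1) (fun lam => (hφ lam).1) hψsol
    (fun lam => (hφ lam).2) (fun lam => hW lam lam) hCθ hCφ hCφ hCψ hbI hbE
  -- a zero of `F` is an eigenvalue of the singular problem, with eigenfunction `φ`
  have hF0 : ∀ lam ∈ 𝒦, F lam ≠ 0 := by
    intro lam hlam h0
    have hL2 := (hφ lam).1.l2w_of_norm_le hs (hCφ lam hlam)
    refine h𝒦_eig lam hlam ⟨φ lam,
      ⟨(hφ lam).1, hL2, ⟨hL2.1.const_mul lam, ?_⟩, ?_, ?_⟩, ?_⟩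
    · refine (hL2.2.const_mul (‖lam‖ ^ 2)).congr (Eventually.of_forall fun x => ?_)
      simp only [norm_mul]
      ring
    · rw [(hφ lam).2]; ring
    · simpa [h0] using! hF lam hlam
    · by_contra! h
      -- A vanishing `φ` would have zero initial data, making `sin α` and `cos α` both zero.
      have hz := (hφ lam).1.apply_left_eq_zero h
      rw [(hφ lam).2, Prod.mk_eq_zero, neg_eq_zero] at hz
      rw [hz.1, hz.2] at hsc
      norm_num at hsc
  have hWeyl : ∀ lam ∈ 𝒦, ∀ μ, P.IsWeylValue ψ (θ lam) (φ lam) μ → μ = -(G lam / F lam) := by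
    intro lam hlam μ hμ
    have h1 : Tendsto (wronskian (θ lam + μ • φ lam) ψ) P.atEnd (𝓝 0) := hμ.2
    have h2 := (hG lam hlam).add ((hF lam hlam).const_mul μ)
    have h3 := tendsto_nhds_unique h1
      (h2.congr fun x => (wronskian_add_smul_left _ _ _ _ _).symm)
    have := hF0 lam hlam
    field_simp
    linear_combination -h3
  have hReg : ∀ n lam μ, wronskian (φ lam) ψ (bn n) ≠ 0 →
      (IsRegWeylValue ψ (θ lam) (φ lam) (bn n) μ ↔
        μ = -(wronskian (θ lam) ψ (bn n) / wronskian (φ lam) ψ (bn n))) := by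
    intro n lam μ h
    change wronskian (θ lam + μ • φ lam) ψ (bn n) = 0 ↔ _
    rw [wronskian_add_smul_left, ← neg_div, eq_div_iff h, add_comm, add_eq_zero_iff_eq_neg]
  have hne : ∀ᶠ n in atTop, ∀ lam ∈ 𝒦, wronskian (φ lam) ψ (bn n) ≠ 0 := by
    rcases 𝒦.eq_empty_or_nonempty with rfl | hn
    · simp
    -- The positive minimum of `‖F‖` on `𝒦` is the tolerance: a zero of `[φ, ψ](bn n)` would put
    -- `‖F‖` below it.
    obtain ⟨l₀, hl₀, hmin⟩ := h𝒦.exists_isMinOn hn hFc.norm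
    filter_upwards [Metric.tendstoUniformlyOn_iff.1 hFu _ (norm_pos_iff.2 (hF0 l₀ hl₀))]
      with n hn lam hlam h0
    have h1 := hn lam hlam
    rw [h0, dist_zero_right] at h1
    exact absurd (hmin hlam) (not_le.2 h1)
  have hnoteig : ∀ n lam, wronskian (φ lam) ψ (bn n) ≠ 0 →
      ¬ P.IsEigenvalueReg α ψ (bn n) lam := fun n lam h =>
    not_isEigenvalueReg_of_wronskian_ne_zero (hbI n) (hθ lam).1 (hφ lam).1 (hθ lam).2
      (hφ lam).2 h
  refine ⟨fun lam hlam => ?_, ?_, ?_⟩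
  · have h := hm lam (h𝒦_eig lam hlam)
    exact ⟨m lam, h, fun μ hμ => (hWeyl lam hlam μ hμ).trans (hWeyl lam hlam _ h).symm⟩
  · filter_upwards [hne] with n hn lam hlam
    exact ⟨hnoteig n lam (hn lam hlam), _, (hReg n lam _ (hn lam hlam)).2 rfl,
      fun μ hμ => (hReg n lam μ (hn lam hlam)).1 hμ⟩
  · have hdiv : TendstoUniformlyOn
        (fun n lam => wronskian (θ lam) ψ (bn n) / wronskian (φ lam) ψ (bn n))
        (fun lam => G lam / F lam) atTop 𝒦 :=
      (tendstoLocallyUniformlyOn_iff_tendstoUniformlyOn_of_compact h𝒦).1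
        (hGu.tendstoLocallyUniformlyOn.div₀ hFu.tendstoLocallyUniformlyOn hGc hFc hF0)
    refine (hdiv.neg.congr ?_).congr_right fun lam hlam =>
      (hWeyl lam hlam _ (hm lam (h𝒦_eig lam hlam))).symm
    filter_upwards [hne] with n hn lam hlam
    exact ((hReg n lam _ (hn lam hlam)).1 (hmn n lam (hnoteig n lam (hn lam hlam)))).symm
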